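/- Let $G=(V,E)$ be a finite simple graph with at least one vertex, let $\overline G$ be its complement, and let $n=|V|$. A weight on $G$ is a function $p:V\to[0,\infty)$; write $\langle p,q\rangle=\sum_{v\in V}p(v)q(v)$. For a weight $p$ define: * the weighted independence number $\alpha_G(p)=\max_I\sum_{v\in I}p(v)$, the maximum over all independent sets $I\subseteq V$; * the weighted Shannon capacity $\Theta_G(p)=\lim_{m\to\infty}\sqrt[m]{\alpha_{G^{\boxtimes m}}(p^{\otimes m})}$, where $G^{\boxtimes m}$ is the $m$-fold strong product of $G$ (vertex set $V^m$; two different $m$-tuples are adjacent if and only if in each coordinate their entries are equal or adjacent in $G$) and $p^{\otimes m}(v_1,\dots,v_m)=p(v_1)\cdots p(v_m)$; * the weighted Lovász number $\vartheta_G(p)=\max_{c,\psi}\sum_{v\in V}p(v)\,|\langle c,\psi_v\rangle|^2$, where $c$ ranges over the unit vectors of $\mathbb R^{n}$ and $\psi$ over the orthonormal representations of $\overline G$, that is, the families $(\psi_v)_{v\in V}$ of unit vectors of $\mathbb R^n$ such that $\psi_u\perp\psi_v$ whenever $u\neq v$ are non-adjacent in $\overline G$; * the weighted fractional packing number $\alpha^*_G(p)=\max_q\sum_{v\in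 V}p(v)q(v)$, where $q:V\to[0,1]$ ranges over the functions with $\sum_{v\in C}q(v)\le1$ for every clique $C$ of $G$ (one-vertex sets count as cliques). For a real-valued function $f$ of weights put $(\mathfrak B f)(p)=\sup_{q\ne0}\frac{\langle p,q\rangle}{f(q)}$, the supremum over all nonzero weights $q$. Define the dual Shannon capacity $\hat\Theta_G=\mathfrak B\,\Theta_{\overline G}$ and the double dual Shannon capacity $\hat{\hat\Theta}_G=\mathfrak B\,\hat\Theta_{\overline G}$. Then for every weight $p$ on $G$ the maxima above are attained, the limit exists, the suprema defining $\hat\Theta_G(p)$ and $\hat{\hat\Theta}_G(p)$ are finite, and $$\alpha_G(p)\le\hat{\hat\Theta}_G(p)\le\Theta_G(p)\le\vartheta_G(p)\le\hat\Theta_G(p)\le\alpha^*_G(p).$$ -/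

import Mathlib

open Filter Topology
open scoped NNReal

/-- The values `⟨p, q⟩ / f q`, where `q` ranges over the nonzero vectors of the nonnegative
orthant. -/
def ratioValues {V : Type*} [Fintype V] (f : (V → ℝ≥0) → ℝ) (p : V → ℝ≥0) : Set ℝ :=
  {x | ∃ q : V → ℝ≥0, q ≠ 0 ∧ x = (∑ v, (p v : ℝ) * (q v : ℝ)) / f q}

/-- The transform `(𝔅 f)(p) = sup_{q ≠ 0} ⟨p, q⟩ / f(q)`. -/
noncomputable def dualTransform {V : Type*} [Fintype V] (f : (V → ℝ≥0) → ℝ)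
    (p : V → ℝ≥0) : ℝ :=
  sSup (ratioValues f p)

namespace SimpleGraph

/-- The total weights `∑_{v ∈ I} p v` of the independent sets `I` of `G`. -/
def indepSetWeights {V : Type*} (G : SimpleGraph V) (p : V → ℝ≥0) : Set ℝ :=
  {x | ∃ I : Finset V, G.IsIndepSet (I : Set V) ∧ x = ∑ v ∈ I, (p v : ℝ)}

/-- The weighted independence number `α_G(p)`. -/
noncomputable def weightedIndepNum {V : Type*} (G : SimpleGraph V) (p : V → ℝ≥0) : ℝ :=
  sSup (G.indepSetWeights p)

/-- The `n`-fold strong product `G ⊠ ⋯ ⊠ G` on the vertex set `Vⁿ`: two different `n`-tuples are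
adjacent iff in every coordinate their entries are equal or adjacent. -/
def strongPower {V : Type*} (G : SimpleGraph V) (n : ℕ) : SimpleGraph (Fin n → V) where
  Adj x y := x ≠ y ∧ ∀ i, x i = y i ∨ G.Adj (x i) (y i)
  symm := ⟨fun _ _ h => ⟨h.1.symm, fun i => (h.2 i).imp Eq.symm fun e => e.symm⟩⟩
  loopless := ⟨fun _ h => h.1 rfl⟩

/-- The tensor power `p^{⊗ n}` of a weight, `(v₁, …, vₙ) ↦ p v₁ ⋯ p vₙ`. -/
def weightPower {V : Type*} (p : V → ℝ≥0) (n : ℕ) : (Fin n → V) → ℝ≥0 :=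
  fun x => ∏ i, p (x i)

/-- The sequence `α_{G^{⊠ n}}(p^{⊗ n})^{1/n}`. -/
noncomputable def shannonSeq {V : Type*} (G : SimpleGraph V) (p : V → ℝ≥0) (n : ℕ) : ℝ :=
  ((G.strongPower n).weightedIndepNum (weightPower p n)) ^ (1 / (n : ℝ))

/-- The weighted Shannon capacity `Θ_G(p) = lim_n α_{G^{⊠ n}}(p^{⊗ n})^{1/n}`. -/
noncomputable def weightedShannonCapacity {V : Type*} (G : SimpleGraph V) (p : V → ℝ≥0) : ℝ :=
  limUnder atTop (G.shannonSeq p)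

/-- `ψ` is an orthonormal representation of `G` in `ℝⁿ`, `n = |V(G)|`: the `ψ v` are unit vectors,
and distinct non-adjacent vertices are sent to orthogonal vectors. -/
def IsOrthonormalRep {V : Type*} [Fintype V] (G : SimpleGraph V)
    (ψ : V → EuclideanSpace ℝ (Fin (Fintype.card V))) : Prop :=
  (∀ v, ‖ψ v‖ = 1) ∧ ∀ u v, u ≠ v → ¬ G.Adj u v → inner ℝ (ψ u) (ψ v) = 0

/-- The values `∑_v p v |⟨c, ψ v⟩|²`, where `c` ranges over the unit vectors and `ψ` over the
orthonormal representations of the complement of `G`. -/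
def lovaszValues {V : Type*} [Fintype V] (G : SimpleGraph V) (p : V → ℝ≥0) : Set ℝ :=
  {x | ∃ (c : EuclideanSpace ℝ (Fin (Fintype.card V)))
      (ψ : V → EuclideanSpace ℝ (Fin (Fintype.card V))),
      ‖c‖ = 1 ∧ Gᶜ.IsOrthonormalRep ψ ∧ x = ∑ v, (p v : ℝ) * |inner ℝ c (ψ v)| ^ 2}

/-- The weighted Lovász number `ϑ_G(p)`. -/
noncomputable def weightedLovaszNumber {V : Type*} [Fintype V] (G : SimpleGraph V)
    (p : V → ℝ≥0) : ℝ :=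
  sSup (G.lovaszValues p)

/-- The values `∑_v p v q v`, where `q : V → [0, 1]` ranges over the vertex weightings of total
weight at most `1` on every clique of `G`. -/
def packingValues {V : Type*} [Fintype V] (G : SimpleGraph V) (p : V → ℝ≥0) : Set ℝ :=
  {x | ∃ q : V → ℝ, (∀ v, q v ∈ Set.Icc (0 : ℝ) 1) ∧
      (∀ C : Finset V, G.IsClique (C : Set V) → ∑ v ∈ C, q v ≤ 1) ∧
      x = ∑ v, (p v : ℝ) * q v}

/-- The weighted fractional packing number `α*_G(p)`. -/
noncomputable def weightedFracPackingNumber {V : Type*} [Fintype V] (G : SimpleGraph V)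
    (p : V → ℝ≥0) : ℝ :=
  sSup (G.packingValues p)

/-- The dual weighted Shannon capacity `Θ̂_G = 𝔅 Θ_{Gᶜ}`. -/
noncomputable def dualShannonCapacity {V : Type*} [Fintype V] (G : SimpleGraph V) :
    (V → ℝ≥0) → ℝ :=
  dualTransform Gᶜ.weightedShannonCapacity

/-- The double dual weighted Shannon capacity `𝔅 Θ̂_{Gᶜ}`. -/
noncomputable def doubleDualShannonCapacity {V : Type*} [Fintype V] (G : SimpleGraph V) :
    (V → ℝ≥0) → ℝ :=
  dualTransform Gᶜ.dualShannonCapacity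

end SimpleGraph

/-! The definition of `𝔅` gives most of the chain. `⟨p, q⟩ ≤ Θ_G(p) Θ̂_{Gᶜ}(q)` says that the double
dual is at most `Θ_G`. As `α ≤ Θ`, dividing `q` by `α_{Gᶜ}(q)` gives a fractional packing, so `Θ̂_G
≤ α*_G`. Testing the double dual on the indicator of an independent set of `G`, a clique of `Gᶜ`,
gives `α_G`. Both inequalities around `ϑ` rest on Lovász's bound
`weightedShannonCapacity_le_of_rep`: tensor powers of an orthonormal representation are orthonormal
on independent sets, and Bessel's inequality applies. Used for `Gᶜ` with the optimal `c, ψ`, it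
yields `ϑ_G ≤ Θ̂_G`. For `Θ_G ≤ ϑ_G` a representation of `G` itself is needed, while `ϑ_G` is a
maximum over those of `Gᶜ`. This is semidefinite duality: `sum_sqrt_mul_sqrt_le` makes `ϑ I - √p
√pᵀ` nonnegative on the positive semidefinite matrices vanishing on edges,
`exists_posSemidef_eq_off_edges` completes it to a positive semidefinite matrix, and the Gram
vectors of that matrix supply the representation. -/

namespace SimpleGraph

/-! ### Weighted independence number -/

section IndepNum

variable {V : Type*} [Finite V]

theorem finite_indepSetWeights (G : SimpleGraph V) (p : V → ℝ≥0) :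
    (G.indepSetWeights p).Finite := by
  refine (Set.finite_range fun I : Finset V => ∑ v ∈ I, (p v : ℝ)).subset ?_
  rintro x ⟨I, -, rfl⟩
  exact ⟨I, rfl⟩

theorem isGreatest_weightedIndepNum (G : SimpleGraph V) (p : V → ℝ≥0) :
    IsGreatest (G.indepSetWeights p) (G.weightedIndepNum p) := by
  have hne : (G.indepSetWeights p).Nonempty := ⟨0, ∅, by simp, by simp⟩
  have hfin := G.finite_indepSetWeights p
  exact ⟨hne.csSup_mem hfin, fun x hx => le_csSup hfin.bddAbove hx⟩

theorem sum_le_weightedIndepNum (G : SimpleGraph V) (p : V → ℝ≥0) {I : Finset V}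
    (hI : G.IsIndepSet (I : Set V)) : ∑ v ∈ I, (p v : ℝ) ≤ G.weightedIndepNum p :=
  (G.isGreatest_weightedIndepNum p).2 ⟨I, hI, rfl⟩

theorem weight_le_weightedIndepNum (G : SimpleGraph V) (p : V → ℝ≥0) (v : V) :
    (p v : ℝ) ≤ G.weightedIndepNum p := by
  simpa using G.sum_le_weightedIndepNum p (I := {v}) (by simp)

theorem weightedIndepNum_nonneg (G : SimpleGraph V) (p : V → ℝ≥0) :
    0 ≤ G.weightedIndepNum p := by
  simpa using G.sum_le_weightedIndepNum p (I := ∅) (by simp)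

theorem weightedIndepNum_le_iff (G : SimpleGraph V) (p : V → ℝ≥0) {a : ℝ} :
    G.weightedIndepNum p ≤ a ↔
      ∀ I : Finset V, G.IsIndepSet (I : Set V) → ∑ v ∈ I, (p v : ℝ) ≤ a := by
  refine ⟨fun h I hI => (G.sum_le_weightedIndepNum p hI).trans h, fun h => ?_⟩
  obtain ⟨I, hI, e⟩ := (G.isGreatest_weightedIndepNum p).1
  exact e ▸ h I hI

theorem weightedIndepNum_pos (G : SimpleGraph V) {p : V → ℝ≥0} (hp : p ≠ 0) :
    0 < G.weightedIndepNum p := by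
  obtain ⟨v, hv⟩ := Function.ne_iff.1 hp
  exact (NNReal.coe_pos.2 (pos_iff_ne_zero.2 hv)).trans_le (G.weight_le_weightedIndepNum p v)

end IndepNum

/-! ### Shannon capacity: existence of the limit -/

section Shannon

variable {V : Type*} [Finite V]

theorem weightedIndepNum_le_strongPower_one (G : SimpleGraph V) (p : V → ℝ≥0) :
    G.weightedIndepNum p ≤ (G.strongPower 1).weightedIndepNum (weightPower p 1) := by
  classical
  refine (G.weightedIndepNum_le_iff p).2 fun I hI => ?_
  have hinj : Function.Injective (fun (v : V) (_ : Fin 1) => v) :=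
    fun a b h => congrFun h 0
  refine le_trans (le_of_eq ?_)
    ((G.strongPower 1).sum_le_weightedIndepNum (weightPower p 1) (I := I.map ⟨_, hinj⟩) ?_)
  · simp [weightPower]
  · rintro x hx y hy hxy ⟨-, h⟩
    simp only [Finset.coe_map, Function.Embedding.coeFn_mk, Set.mem_image,
      SetLike.mem_coe] at hx hy
    obtain ⟨a, ha, rfl⟩ := hx
    obtain ⟨b, hb, rfl⟩ := hy
    have hab : a ≠ b := fun e => hxy (by rw [e])
    exact hI ha hb hab ((h 0).resolve_left hab)

/-- Concatenating the tuples of two independent sets gives an independent set; this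
supermultiplicativity feeds Fekete's lemma. -/
theorem weightedIndepNum_strongPower_mul_le (G : SimpleGraph V) (p : V → ℝ≥0) (m n : ℕ) :
    (G.strongPower m).weightedIndepNum (weightPower p m) *
        (G.strongPower n).weightedIndepNum (weightPower p n) ≤
      (G.strongPower (m + n)).weightedIndepNum (weightPower p (m + n)) := by
  classical
  obtain ⟨I, hI, eI⟩ := ((G.strongPower m).isGreatest_weightedIndepNum (weightPower p m)).1
  obtain ⟨J, hJ, eJ⟩ := ((G.strongPower n).isGreatest_weightedIndepNum (weightPower p n)).1
  refine le_trans (le_of_eq ?_)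
    ((G.strongPower (m + n)).sum_le_weightedIndepNum (weightPower p (m + n))
      (I := (I ×ˢ J).map (Fin.appendEquiv m n).toEmbedding) ?_)
  · rw [eI, eJ, Finset.sum_mul_sum, Finset.sum_map, Finset.sum_product]
    simp [weightPower, Fin.prod_univ_add, Fin.appendEquiv]
  · rintro x hx y hy hxy ⟨-, h⟩
    simp only [Finset.coe_map, Set.mem_image, SetLike.mem_coe, Finset.mem_product] at hx hy
    obtain ⟨⟨a, b⟩, ⟨ha, hb⟩, rfl⟩ := hx
    obtain ⟨⟨a', b'⟩, ⟨ha', hb'⟩, rfl⟩ := hy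
    have h1 : a = a' := by
      by_contra hne
      refine hI ha ha' hne ⟨hne, fun i => ?_⟩
      simpa [Fin.appendEquiv] using h (Fin.castAdd n i)
    have h2 : b = b' := by
      by_contra hne
      refine hJ hb hb' hne ⟨hne, fun i => ?_⟩
      simpa [Fin.appendEquiv] using h (Fin.natAdd m i)
    exact hxy (by rw [h1, h2])

theorem weightPower_ne_zero {V : Type*} {p : V → ℝ≥0} (hp : p ≠ 0) (n : ℕ) :
    weightPower p n ≠ 0 := by
  obtain ⟨v, hv⟩ := Function.ne_iff.1 hp
  refine Function.ne_iff.2 ⟨fun _ => v, ?_⟩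
  simpa [weightPower] using fun h => absurd h hv

theorem weightedIndepNum_strongPower_le {V : Type*} [Fintype V] (G : SimpleGraph V)
    (p : V → ℝ≥0) (n : ℕ) :
    (G.strongPower n).weightedIndepNum (weightPower p n) ≤ (∑ v, (p v : ℝ)) ^ n := by
  classical
  refine ((G.strongPower n).weightedIndepNum_le_iff _).2 fun I _ => ?_
  calc ∑ x ∈ I, (weightPower p n x : ℝ)
      ≤ ∑ x, (weightPower p n x : ℝ) :=
        Finset.sum_le_univ_sum_of_nonneg fun x => NNReal.coe_nonneg _
    _ = (∑ v, (p v : ℝ)) ^ n := by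
        simp only [weightPower, NNReal.coe_prod]
        rw [← Fintype.piFinset_univ, ← Finset.prod_univ_sum (fun _ => Finset.univ) fun _ v => (p v : ℝ)]
        simp

theorem shannonSeq_zero_weight (G : SimpleGraph V) {n : ℕ} (hn : n ≠ 0) :
    G.shannonSeq 0 n = 0 := by
  obtain ⟨I, -, e⟩ :=
    ((G.strongPower n).isGreatest_weightedIndepNum (weightPower 0 n)).1
  have : (G.strongPower n).weightedIndepNum (weightPower 0 n) = 0 := by
    rw [e]
    exact Finset.sum_eq_zero fun x _ => by simp [weightPower, hn]
  rw [shannonSeq, this, Real.zero_rpow (by positivity)]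

theorem weightedShannonCapacity_of_tendsto {V : Type*} {G : SimpleGraph V} {p : V → ℝ≥0} {a : ℝ}
    (h : Tendsto (G.shannonSeq p) atTop (𝓝 a)) :
    G.weightedShannonCapacity p = a :=
  h.limUnder_eq

theorem exists_tendsto_shannonSeq {V : Type*} [Fintype V] (G : SimpleGraph V) (p : V → ℝ≥0) :
    ∃ a, Tendsto (G.shannonSeq p) atTop (𝓝 a) ∧ G.weightedIndepNum p ≤ a := by
  -- Fekete's lemma is applied to logarithms, so the zero weight is treated apart.
  rcases eq_or_ne p 0 with rfl | hp
  · refine ⟨0, ?_, (G.weightedIndepNum_le_iff 0).2 fun I _ => by simp⟩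
    refine tendsto_const_nhds.congr' ?_
    filter_upwards [eventually_ne_atTop 0] with n hn
    rw [G.shannonSeq_zero_weight hn]
  set a : ℕ → ℝ := fun n => (G.strongPower n).weightedIndepNum (weightPower p n) with ha
  have hpos : ∀ n, 0 < a n := fun n =>
    (G.strongPower n).weightedIndepNum_pos (weightPower_ne_zero hp n)
  have hsub : Subadditive fun n => -Real.log (a n) := by
    intro m n
    have := Real.log_le_log (mul_pos (hpos m) (hpos n))
      (G.weightedIndepNum_strongPower_mul_le p m n)
    rw [Real.log_mul (hpos m).ne' (hpos n).ne'] at this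
    change -Real.log (a (m + n)) ≤ -Real.log (a m) + -Real.log (a n)
    linarith
  have hbdd : BddBelow (Set.range fun n : ℕ => -Real.log (a n) / n) := by
    -- The `0` covers the index `n = 0`, where division by zero gives the value `0`.
    refine ⟨min 0 (-Real.log (∑ v, (p v : ℝ))), ?_⟩
    rintro _ ⟨n, rfl⟩
    rcases Nat.eq_zero_or_pos n with rfl | hn
    · simp
    refine (min_le_right _ _).trans ?_
    have h1 := Real.log_le_log (hpos n) (G.weightedIndepNum_strongPower_le p n)
    rw [Real.log_pow] at h1
    have hn' : (0 : ℝ) < n := by exact_mod_cast hn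
    rw [le_div_iff₀ hn']
    linarith
  have hseq : ∀ n, G.shannonSeq p n = Real.exp (-(-Real.log (a n) / n)) := by
    intro n
    rw [shannonSeq, Real.rpow_def_of_pos (hpos n)]
    congr 1
    ring
  refine ⟨Real.exp (-hsub.lim), ?_, ?_⟩
  · rw [show G.shannonSeq p = _ from funext hseq]
    exact (Real.continuous_exp.tendsto _).comp (hsub.tendsto_lim hbdd).neg
  · have h1 := hsub.lim_le_div hbdd one_ne_zero
    have h2 : Real.log (a 1) ≤ -hsub.lim := by
      simp only [Nat.cast_one, div_one] at h1
      linarith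
    calc G.weightedIndepNum p ≤ a 1 := G.weightedIndepNum_le_strongPower_one p
      _ = Real.exp (Real.log (a 1)) := (Real.exp_log (hpos 1)).symm
      _ ≤ _ := Real.exp_le_exp.2 h2

variable {V : Type*} [Fintype V]

theorem tendsto_shannonSeq (G : SimpleGraph V) (p : V → ℝ≥0) :
    Tendsto (G.shannonSeq p) atTop (𝓝 (G.weightedShannonCapacity p)) := by
  obtain ⟨a, h, -⟩ := G.exists_tendsto_shannonSeq p
  rwa [weightedShannonCapacity_of_tendsto h]

theorem weightedIndepNum_le_weightedShannonCapacity (G : SimpleGraph V) (p : V → ℝ≥0) :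
    G.weightedIndepNum p ≤ G.weightedShannonCapacity p := by
  obtain ⟨a, h, h'⟩ := G.exists_tendsto_shannonSeq p
  rwa [weightedShannonCapacity_of_tendsto h]

theorem weightedShannonCapacity_nonneg (G : SimpleGraph V) (p : V → ℝ≥0) :
    0 ≤ G.weightedShannonCapacity p :=
  (G.weightedIndepNum_nonneg p).trans (G.weightedIndepNum_le_weightedShannonCapacity p)

theorem weightedShannonCapacity_pos (G : SimpleGraph V) {p : V → ℝ≥0} (hp : p ≠ 0) :
    0 < G.weightedShannonCapacity p :=
  (G.weightedIndepNum_pos hp).trans_le (G.weightedIndepNum_le_weightedShannonCapacity p)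

theorem weightedShannonCapacity_le_of_forall_pow (G : SimpleGraph V) (p : V → ℝ≥0) {t : ℝ}
    (ht : 0 ≤ t)
    (h : ∀ n, (G.strongPower n).weightedIndepNum (weightPower p n) ≤ t ^ n) :
    G.weightedShannonCapacity p ≤ t := by
  refine le_of_tendsto (G.tendsto_shannonSeq p) ?_
  filter_upwards [eventually_ne_atTop 0] with n hn
  calc G.shannonSeq p n ≤ (t ^ n) ^ (1 / (n : ℝ)) :=
        Real.rpow_le_rpow (weightedIndepNum_nonneg _ _) (h n) (by positivity)
    _ = t := by rw [one_div, Real.pow_rpow_inv_natCast ht hn]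

end Shannon

/-! ### Lovász's bound by tensor powers -/

section TensorPower

/-- The `n`-fold tensor product `x₁ ⊗ ⋯ ⊗ xₙ` of vectors of `ℝ^ι`, in coordinates. -/
noncomputable def tensorVec {ι : Type*} {n : ℕ} (x : Fin n → EuclideanSpace ℝ ι) :
    EuclideanSpace ℝ (Fin n → ι) :=
  WithLp.toLp 2 fun j => ∏ i, x i (j i)

theorem inner_tensorVec {ι : Type*} [Fintype ι] {n : ℕ} (x y : Fin n → EuclideanSpace ℝ ι) :
    inner ℝ (tensorVec x) (tensorVec y) = ∏ i, inner ℝ (x i) (y i) := by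
  classical
  simp only [tensorVec, PiLp.inner_apply, RCLike.inner_apply, conj_trivial]
  rw [Finset.prod_univ_sum, Fintype.piFinset_univ]
  simp only [Finset.prod_mul_distrib]

variable {V : Type*} [Fintype V]

/-- Lovász's bound: an orthonormal representation of `G` with handle `c` bounds the Shannon
capacity of `G`. -/
theorem weightedShannonCapacity_le_of_rep {ι : Type*} [Fintype ι] (G : SimpleGraph V)
    (p : V → ℝ≥0) {t : ℝ} (ht : 0 ≤ t) (c : EuclideanSpace ℝ ι) (hc : ‖c‖ = 1)
    (φ : V → EuclideanSpace ℝ ι) (hφ : ∀ v, ‖φ v‖ = 1)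
    (horth : ∀ u v, u ≠ v → ¬ G.Adj u v → inner ℝ (φ u) (φ v) = 0)
    (hp : ∀ v, (p v : ℝ) ≤ t * (inner ℝ (φ v) c) ^ 2) :
    G.weightedShannonCapacity p ≤ t := by
  refine G.weightedShannonCapacity_le_of_forall_pow p ht fun n => ?_
  refine ((G.strongPower n).weightedIndepNum_le_iff _).2 fun I hI => ?_
  let Φ : I → EuclideanSpace ℝ (Fin n → ι) := fun x => tensorVec fun i => φ (x.1 i)
  let C : EuclideanSpace ℝ (Fin n → ι) := tensorVec fun _ => c
  have hC : ‖C‖ ^ 2 = 1 := by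
    rw [← real_inner_self_eq_norm_sq, inner_tensorVec]
    simp [hc]
  have hΦ : Orthonormal ℝ Φ := by
    classical
    rw [orthonormal_iff_ite]
    intro x y
    rw [inner_tensorVec]
    split_ifs with hxy
    · subst hxy
      simp [hφ]
    -- Distinct tuples of an independent set have a coordinate with distinct non-adjacent entries,
    -- and its factor vanishes.
    · have hxy' : x.1 ≠ y.1 := fun h => hxy (Subtype.ext h)
      have hna := hI x.2 y.2 hxy'
      have : ∃ i, ¬ (x.1 i = y.1 i ∨ G.Adj (x.1 i) (y.1 i)) := by
        by_contra! h
        exact hna ⟨hxy', h⟩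
      obtain ⟨i, hi⟩ := this
      rw [not_or] at hi
      exact Finset.prod_eq_zero (Finset.mem_univ i) (horth _ _ hi.1 hi.2)
  -- Bessel's inequality for the unit vector `C`.
  have hB := hΦ.sum_inner_products_le C (s := Finset.univ)
  rw [hC] at hB
  calc ∑ x ∈ I, (weightPower p n x : ℝ)
      ≤ ∑ x ∈ I, t ^ n * ∏ i, (inner ℝ (φ (x i)) c) ^ 2 := by
        refine Finset.sum_le_sum fun x _ => ?_
        rw [weightPower, NNReal.coe_prod]
        calc ∏ i, (p (x i) : ℝ) ≤ ∏ i, (t * (inner ℝ (φ (x i)) c) ^ 2) :=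
              Finset.prod_le_prod (fun i _ => NNReal.coe_nonneg _) fun i _ => hp _
          _ = _ := by simp [Finset.prod_mul_distrib]
    _ = t ^ n * ∑ x : I, ‖inner ℝ (Φ x) C‖ ^ 2 := by
        rw [← Finset.mul_sum, ← Finset.sum_coe_sort I]
        congr 1
        refine Finset.sum_congr rfl fun x _ => ?_
        rw [inner_tensorVec, Real.norm_eq_abs, sq_abs, Finset.prod_pow]
    _ ≤ t ^ n * 1 := by gcongr
    _ = t ^ n := mul_one _

end TensorPower

end SimpleGraph

/-! ### Positive semidefinite matrices -/

open scoped MatrixOrder ComplexOrder Matrix.Norms.L2Operator in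
/-- A positive semidefinite real matrix is a Gram matrix. -/
theorem Matrix.PosSemidef.exists_inner_eq {ι : Type*} [Fintype ι] {M : Matrix ι ι ℝ}
    (hM : M.PosSemidef) :
    ∃ z : ι → EuclideanSpace ℝ ι, ∀ u v, inner ℝ (z u) (z v) = M u v := by
  classical
  obtain ⟨B, rfl⟩ := CStarAlgebra.nonneg_iff_eq_star_mul_self.mp hM.nonneg
  refine ⟨fun u => WithLp.toLp 2 fun i => B i u, fun u v => ?_⟩
  simp [PiLp.inner_apply, Matrix.mul_apply, Matrix.star_apply, mul_comm]

theorem Matrix.posSemidef_of_sum_nonneg {ι : Type*} [Fintype ι] {M : Matrix ι ι ℝ}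
    (hsymm : ∀ u v, M u v = M v u)
    (h : ∀ x : ι → ℝ, 0 ≤ ∑ u, ∑ v, M u v * (x u * x v)) : M.PosSemidef := by
  refine .of_dotProduct_mulVec_nonneg ?_ fun x => ?_
  · ext u v
    simpa using hsymm v u
  · refine (h x).trans_eq ?_
    simp only [dotProduct, Matrix.mulVec, Finset.mul_sum]
    refine Finset.sum_congr rfl fun u _ => Finset.sum_congr rfl fun v _ => ?_
    simp
    ring

namespace SimpleGraph

variable {V : Type*} [Fintype V]

/-! ### Lovász number and its semidefinite bound -/

section LovaszNumber

theorem lovaszValues_nonempty [Nonempty V] (G : SimpleGraph V) (p : V → ℝ≥0) :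
    (G.lovaszValues p).Nonempty := by
  classical
  let ψ : V → EuclideanSpace ℝ (Fin (Fintype.card V)) :=
    fun v => EuclideanSpace.single (Fintype.equivFin V v) (1 : ℝ)
  refine ⟨_, ψ (Classical.arbitrary V), ψ, by simp [ψ], ⟨fun v => by simp [ψ], ?_⟩, rfl⟩
  intro u v huv _
  simp [ψ, EuclideanSpace.inner_single_left, huv]

theorem isCompact_lovaszValues (G : SimpleGraph V) (p : V → ℝ≥0) :
    IsCompact (G.lovaszValues p) := by
  let E := EuclideanSpace ℝ (Fin (Fintype.card V))
  let K : Set (E × (V → E)) := {x | ‖x.1‖ = 1 ∧ Gᶜ.IsOrthonormalRep x.2}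
  have hclosed : IsClosed K := by
    have : K = {x | ‖x.1‖ = 1} ∩ ((⋂ v, {x | ‖x.2 v‖ = 1}) ∩
        ⋂ u, ⋂ v, ⋂ (_ : u ≠ v), ⋂ (_ : ¬ Gᶜ.Adj u v), {x | inner ℝ (x.2 u) (x.2 v) = 0}) := by
      ext x
      simp only [K, IsOrthonormalRep, Set.mem_ofPred_eq, Set.mem_inter_iff, Set.mem_iInter]
    rw [this]
    refine (isClosed_eq (by fun_prop) continuous_const).inter
      ((isClosed_iInter fun v => isClosed_eq (by fun_prop) continuous_const).inter ?_)
    exact isClosed_iInter fun u => isClosed_iInter fun v => isClosed_iInter fun _ =>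
      isClosed_iInter fun _ => isClosed_eq (by fun_prop) continuous_const
  have hK : IsCompact K := by
    refine Metric.isCompact_of_isClosed_isBounded hclosed
      ((Metric.isBounded_closedBall (x := 0) (r := 1)).subset ?_)
    intro x hx
    rw [mem_closedBall_zero_iff, Prod.norm_def, max_le_iff]
    exact ⟨hx.1.le, (pi_norm_le_iff_of_nonneg zero_le_one).2 fun v => (hx.2.1 v).le⟩
  have hcont : Continuous fun x : E × (V → E) =>
      ∑ v, (p v : ℝ) * |inner ℝ x.1 (x.2 v)| ^ 2 := by fun_prop
  convert hK.image hcont using 1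
  ext y
  constructor
  · rintro ⟨c, ψ, hc, hψ, rfl⟩
    exact ⟨(c, ψ), ⟨hc, hψ⟩, rfl⟩
  · rintro ⟨⟨c, ψ⟩, ⟨hc, hψ⟩, rfl⟩
    exact ⟨c, ψ, hc, hψ, rfl⟩

theorem isGreatest_weightedLovaszNumber [Nonempty V] (G : SimpleGraph V) (p : V → ℝ≥0) :
    IsGreatest (G.lovaszValues p) (G.weightedLovaszNumber p) :=
  (G.isCompact_lovaszValues p).isGreatest_sSup (G.lovaszValues_nonempty p)

theorem weightedLovaszNumber_nonneg [Nonempty V] (G : SimpleGraph V) (p : V → ℝ≥0) :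
    0 ≤ G.weightedLovaszNumber p := by
  obtain ⟨c, ψ, -, -, h⟩ := (G.isGreatest_weightedLovaszNumber p).1
  rw [h]
  positivity

/-- Reindexing coordinates by `V` is an isometry; Gram vectors of `V × V` matrices live in this
space. -/
theorem sum_inner_sq_le_weightedLovaszNumber [Nonempty V] (G : SimpleGraph V) (p : V → ℝ≥0)
    {c : EuclideanSpace ℝ V} (hc : ‖c‖ = 1) {ψ : V → EuclideanSpace ℝ V} (hψ : ∀ v, ‖ψ v‖ = 1)
    (horth : ∀ u v, G.Adj u v → inner ℝ (ψ u) (ψ v) = 0) :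
    ∑ v, (p v : ℝ) * (inner ℝ c (ψ v)) ^ 2 ≤ G.weightedLovaszNumber p := by
  let e := LinearIsometryEquiv.piLpCongrLeft 2 ℝ ℝ (Fintype.equivFin V)
  refine (G.isGreatest_weightedLovaszNumber p).2 ⟨e c, fun v => e (ψ v), ?_, ⟨?_, ?_⟩, ?_⟩
  · rw [e.norm_map, hc]
  · intro v
    rw [e.norm_map, hψ]
  · intro u v huv hadj
    rw [e.inner_map_map]
    refine horth u v ?_
    simpa [huv] using hadj
  · simp only [e.inner_map_map, sq_abs]

theorem weight_le_weightedLovaszNumber (G : SimpleGraph V) (p : V → ℝ≥0) (v : V) :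
    (p v : ℝ) ≤ G.weightedLovaszNumber p := by
  classical
  have : Nonempty V := ⟨v⟩
  have h := G.sum_inner_sq_le_weightedLovaszNumber p (c := EuclideanSpace.single v 1)
    (by simp) (ψ := fun v => EuclideanSpace.single v 1) (by simp) ?_
  · refine le_trans (le_of_eq ?_) h
    simp [EuclideanSpace.inner_single_left]
  · intro u w huw
    simp [EuclideanSpace.inner_single_left, huw.ne]

/-- With `w` the sum and `c = w / ‖w‖`, one has `‖w‖ = ⟨c, w⟩`. Normalising the `z v` gives a
competitor for `ϑ`, and Cauchy–Schwarz separates the norms from the inner products. -/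
theorem norm_sum_sqrt_smul_sq_le [Nonempty V] (G : SimpleGraph V) (p : V → ℝ≥0)
    {z : V → EuclideanSpace ℝ V} (hz : ∀ v, z v ≠ 0)
    (horth : ∀ u v, G.Adj u v → inner ℝ (z u) (z v) = 0) :
    ‖∑ v, √(p v : ℝ) • z v‖ ^ 2 ≤ G.weightedLovaszNumber p * ∑ v, ‖z v‖ ^ 2 := by
  set w := ∑ v, √(p v : ℝ) • z v with hw
  have hθ := G.weightedLovaszNumber_nonneg p
  rcases eq_or_ne w 0 with h0 | h0
  · rw [h0]
    simp only [norm_zero, ne_eq, OfNat.ofNat_ne_zero, not_false_eq_true, zero_pow]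
    positivity
  have hw0 : ‖w‖ ≠ 0 := norm_ne_zero_iff.2 h0
  set c := ‖w‖⁻¹ • w with hc
  set ψ : V → EuclideanSpace ℝ V := fun v => ‖z v‖⁻¹ • z v with hψ
  have hzψ : ∀ v, z v = ‖z v‖ • ψ v := fun v => by
    rw [hψ, smul_smul, mul_inv_cancel₀ (norm_ne_zero_iff.2 (hz v)), one_smul]
  have hc1 : ‖c‖ = 1 := by
    rw [hc, norm_smul, norm_inv, norm_norm, inv_mul_cancel₀ hw0]
  have hψ1 : ∀ v, ‖ψ v‖ = 1 := fun v => by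
    rw [hψ, norm_smul, norm_inv, norm_norm, inv_mul_cancel₀ (norm_ne_zero_iff.2 (hz v))]
  have hcw : inner ℝ c w = ‖w‖ := by
    rw [hc, real_inner_smul_left, real_inner_self_eq_norm_sq]
    field_simp
  have hexp : inner ℝ c w = ∑ v, ‖z v‖ * (√(p v : ℝ) * inner ℝ c (ψ v)) := by
    rw [hw, inner_sum]
    refine Finset.sum_congr rfl fun v _ => ?_
    rw [real_inner_smul_right]
    conv_lhs => rw [hzψ v]
    rw [real_inner_smul_right]
    ring
  have hL := G.sum_inner_sq_le_weightedLovaszNumber p (c := c) hc1 (ψ := ψ) hψ1 fun u v huv => by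
      simp only [hψ, real_inner_smul_left, real_inner_smul_right, horth u v huv, mul_zero]
  calc ‖w‖ ^ 2 = (∑ v, ‖z v‖ * (√(p v : ℝ) * inner ℝ c (ψ v))) ^ 2 := by rw [← hexp, hcw]
    _ ≤ (∑ v, ‖z v‖ ^ 2) * ∑ v, (√(p v : ℝ) * inner ℝ c (ψ v)) ^ 2 :=
        Finset.sum_mul_sq_le_sq_mul_sq _ _ _
    _ = (∑ v, ‖z v‖ ^ 2) * ∑ v, (p v : ℝ) * (inner ℝ c (ψ v)) ^ 2 := by
        simp only [mul_pow, Real.sq_sqrt (NNReal.coe_nonneg _)]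
    _ ≤ (∑ v, ‖z v‖ ^ 2) * G.weightedLovaszNumber p :=
        mul_le_mul_of_nonneg_left hL (Finset.sum_nonneg fun v _ => sq_nonneg _)
    _ = _ := mul_comm _ _

/-- The semidefinite upper bound `√pᵀ M √p ≤ ϑ_G(p) tr M` for positive semidefinite `M` vanishing
on the edges of `G`. -/
theorem sum_sqrt_mul_sqrt_le [Nonempty V] (G : SimpleGraph V) (p : V → ℝ≥0)
    {M : Matrix V V ℝ} (hM : M.PosSemidef) (hadj : ∀ u v, G.Adj u v → M u v = 0) :
    ∑ u, ∑ v, M u v * (√(p u : ℝ) * √(p v : ℝ)) ≤ G.weightedLovaszNumber p * ∑ v, M v v := by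
  classical
  -- Adding `ε I` keeps the zeros on edges and makes every Gram vector nonzero, so that it can be
  -- normalised; then `ε → 0`.
  have key : ∀ ε : ℝ, 0 < ε →
      ∑ u, ∑ v, M u v * (√(p u : ℝ) * √(p v : ℝ)) + ε * ∑ v, (p v : ℝ) ≤
        G.weightedLovaszNumber p * (∑ v, M v v + ε * Fintype.card V) := by
    intro ε hε
    have hMε : (M + ε • (1 : Matrix V V ℝ)).PosSemidef :=
      hM.add (Matrix.PosSemidef.one.smul hε.le)
    obtain ⟨z, hz⟩ := hMε.exists_inner_eq
    have hdiag : ∀ v, ‖z v‖ ^ 2 = M v v + ε := fun v => by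
      rw [← real_inner_self_eq_norm_sq, hz]
      simp
    have hM0 : ∀ v, 0 ≤ M v v := fun v => hM.diag_nonneg
    have h := G.norm_sum_sqrt_smul_sq_le p (z := z) (fun v hv => ?_) fun u v huv => ?_
    · rw [← real_inner_self_eq_norm_sq] at h
      simp only [sum_inner, inner_sum, real_inner_smul_left, real_inner_smul_right, hz,
        hdiag] at h
      refine le_trans (le_of_eq ?_) (h.trans_eq ?_)
      · have : ∀ u v, √(p v : ℝ) * (√(p u : ℝ) * (M + ε • (1 : Matrix V V ℝ)) u v) =
            M u v * (√(p u : ℝ) * √(p v : ℝ)) + if u = v then ε * (p u : ℝ) else 0 := by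
          intro u v
          rcases eq_or_ne u v with rfl | huv
          · have := Real.mul_self_sqrt (NNReal.coe_nonneg (p u))
            simp only [Matrix.add_apply, Matrix.smul_apply, Matrix.one_apply_eq, smul_eq_mul,
              mul_one, if_true]
            linear_combination ε * this
          · simp [huv]
            ring
        symm
        rw [Finset.sum_comm]
        simp only [this, Finset.sum_add_distrib, Finset.mul_sum]
        simp
      · simp [Finset.sum_add_distrib, mul_comm]
    · have := hdiag v
      rw [hv] at this
      have := hM0 v
      norm_num at *
      linarith
    · rw [hz]
      simp [hadj u v huv, huv.ne]
  have h1 : Tendsto (fun ε : ℝ => ∑ u, ∑ v, M u v * (√(p u : ℝ) * √(p v : ℝ)) +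
      ε * ∑ v, (p v : ℝ)) (𝓝[>] 0)
      (𝓝 (∑ u, ∑ v, M u v * (√(p u : ℝ) * √(p v : ℝ)) + 0 * ∑ v, (p v : ℝ))) :=
    (Continuous.tendsto (by fun_prop) _).mono_left nhdsWithin_le_nhds
  have h2 : Tendsto (fun ε : ℝ => G.weightedLovaszNumber p *
      (∑ v, M v v + ε * Fintype.card V)) (𝓝[>] 0)
      (𝓝 (G.weightedLovaszNumber p * (∑ v, M v v + 0 * Fintype.card V))) :=
    (Continuous.tendsto (by fun_prop) _).mono_left nhdsWithin_le_nhds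
  have := le_of_tendsto_of_tendsto h1 h2
    (eventually_nhdsWithin_of_forall fun ε hε => key ε hε)
  simpa using this

end LovaszNumber

/-! ### Fractional packing number -/

section Packing

theorem isGreatest_weightedFracPackingNumber (G : SimpleGraph V) (p : V → ℝ≥0) :
    IsGreatest (G.packingValues p) (G.weightedFracPackingNumber p) := by
  let K : Set (V → ℝ) := (Set.univ.pi fun _ => Set.Icc (0 : ℝ) 1) ∩
    ⋂ C : Finset V, ⋂ (_ : G.IsClique (C : Set V)), {q | ∑ v ∈ C, q v ≤ 1}
  have hK : IsCompact K := (isCompact_univ_pi fun _ => isCompact_Icc).inter_right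
    (isClosed_iInter fun C => isClosed_iInter fun _ =>
      isClosed_le (by fun_prop) continuous_const)
  have himage : G.packingValues p = (fun q : V → ℝ => ∑ v, (p v : ℝ) * q v) '' K := by
    ext x
    simp only [packingValues, K, Set.mem_ofPred_eq, Set.mem_image, Set.mem_inter_iff,
      Set.mem_univ_pi, Set.mem_iInter]
    constructor
    · rintro ⟨q, h1, h2, rfl⟩
      exact ⟨q, ⟨h1, h2⟩, rfl⟩
    · rintro ⟨q, ⟨h1, h2⟩, rfl⟩
      exact ⟨q, h1, h2, rfl⟩
  have hcomp : IsCompact (G.packingValues p) := himage ▸ hK.image (by fun_prop)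
  exact hcomp.isGreatest_sSup ⟨0, 0, by simp, by simp, by simp⟩

theorem weightedFracPackingNumber_le_one [DecidableEq V] (G : SimpleGraph V) {p : V → ℝ≥0} {C : Finset V}
    (hC : G.IsClique (C : Set V)) (hp : ∀ v, (p v : ℝ) = if v ∈ C then 1 else 0) :
    G.weightedFracPackingNumber p ≤ 1 := by
  obtain ⟨q, -, hq, h⟩ := (G.isGreatest_weightedFracPackingNumber p).1
  rw [h]
  simpa [hp] using hq C hC

end Packing

end SimpleGraph

/-! ### Semidefinite duality by Riesz extension -/

theorem abs_mul_le_sum_sq {ι : Type*} [Fintype ι] (x : ι → ℝ) (u v : ι) :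
    |x u * x v| ≤ ∑ w, x w ^ 2 := by
  have hu := Finset.single_le_sum (f := fun w => x w ^ 2) (fun w _ => sq_nonneg (x w))
    (Finset.mem_univ u)
  have hv := Finset.single_le_sum (f := fun w => x w ^ 2) (fun w _ => sq_nonneg (x w))
    (Finset.mem_univ v)
  rw [abs_le]
  constructor <;> nlinarith [sq_nonneg (x u + x v), sq_nonneg (x u - x v)]

/-- The convex cone of the real square matrices with nonnegative quadratic form. -/
def nonnegQuadFormCone (ι : Type*) [Fintype ι] : PointedCone ℝ (Matrix ι ι ℝ) where
  carrier := {M | ∀ x : ι → ℝ, 0 ≤ ∑ u, ∑ v, M u v * (x u * x v)}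
  zero_mem' := fun x => by simp
  add_mem' := fun {M N} hM hN x => by
    have := add_nonneg (hM x) (hN x)
    simpa only [Matrix.add_apply, add_mul, Finset.sum_add_distrib] using this
  smul_mem' := fun c M hM x => by
    have : 0 ≤ (c : ℝ) * ∑ u, ∑ v, M u v * (x u * x v) := mul_nonneg c.2 (hM x)
    simp only [Finset.mul_sum, ← mul_assoc] at this
    simp only [← mul_assoc]
    exact this

theorem mem_nonnegQuadFormCone {ι : Type*} [Fintype ι] {M : Matrix ι ι ℝ} :
    M ∈ nonnegQuadFormCone ι ↔ ∀ x : ι → ℝ, 0 ≤ ∑ u, ∑ v, M u v * (x u * x v) :=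
  Iff.rfl

/-- This is the cofinality hypothesis of the Riesz extension theorem; multiples of the identity lie
in `symmVanishing`. -/
theorem exists_smul_one_add_mem_nonnegQuadFormCone {ι : Type*} [Fintype ι] [DecidableEq ι]
    (Y : Matrix ι ι ℝ) : ∃ t : ℝ, t • (1 : Matrix ι ι ℝ) + Y ∈ nonnegQuadFormCone ι := by
  refine ⟨∑ u, ∑ v, |Y u v|, mem_nonnegQuadFormCone.2 fun x => ?_⟩
  set t := ∑ u, ∑ v, |Y u v| with ht
  have h1 : ∑ u, ∑ v, (t • (1 : Matrix ι ι ℝ) + Y) u v * (x u * x v) =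
      t * ∑ w, x w ^ 2 + ∑ u, ∑ v, Y u v * (x u * x v) := by
    simp [add_mul, Finset.sum_add_distrib, Matrix.one_apply, Finset.mul_sum, sq]
  have h2 : ∑ u, ∑ v, -(Y u v * (x u * x v)) ≤ ∑ u, ∑ v, |Y u v| * ∑ w, x w ^ 2 := by
    refine Finset.sum_le_sum fun u _ => Finset.sum_le_sum fun v _ => ?_
    refine (neg_le_abs _).trans ?_
    rw [abs_mul]
    exact mul_le_mul_of_nonneg_left (abs_mul_le_sum_sq x u v) (abs_nonneg _)
  simp only [Finset.sum_neg_distrib, ← Finset.sum_mul] at h2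
  rw [h1]
  linarith

namespace SimpleGraph

variable {V : Type*} [Fintype V]

/-- The symmetric matrices that vanish on the edges of `G`. -/
def symmVanishing (G : SimpleGraph V) : Submodule ℝ (Matrix V V ℝ) where
  carrier := {M | (∀ u v, M u v = M v u) ∧ ∀ u v, G.Adj u v → M u v = 0}
  zero_mem' := by simp
  add_mem' := fun {M N} hM hN => ⟨fun u v => by simp [hM.1 u v, hN.1 u v],
    fun u v h => by simp [hM.2 u v h, hN.2 u v h]⟩
  smul_mem' := fun c M hM => ⟨fun u v => by simp [hM.1 u v], fun u v h => by simp [hM.2 u v h]⟩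

/-- A symmetric matrix `C` that is nonnegative on the positive semidefinite matrices vanishing on
the edges of `G` becomes positive semidefinite after changing its entries on the edges. -/
theorem exists_posSemidef_eq_off_edges (G : SimpleGraph V) (C : Matrix V V ℝ)
    (hC : ∀ u v, C u v = C v u)
    (h : ∀ M : Matrix V V ℝ, M.PosSemidef → (∀ u v, G.Adj u v → M u v = 0) →
      0 ≤ ∑ u, ∑ v, M u v * C u v) :
    ∃ Z : Matrix V V ℝ, Z.PosSemidef ∧ ∀ u v, ¬ G.Adj u v → Z u v = C u v := by
  classical
  let F : Matrix V V ℝ →ₗ[ℝ] ℝ :=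
    { toFun := fun M => ∑ u, ∑ v, M u v * C u v
      map_add' := fun M N => by simp [add_mul, Finset.sum_add_distrib]
      map_smul' := fun c M => by simp [Finset.mul_sum, mul_assoc] }
  let f : Matrix V V ℝ →ₗ.[ℝ] ℝ := ⟨G.symmVanishing, F.domRestrict G.symmVanishing⟩
  -- Pairing with `C` extends from `symmVanishing` to a functional `g` on all matrices, nonnegative
  -- on the whole cone.
  obtain ⟨g, hgf, hg⟩ := riesz_extension (nonnegQuadFormCone V) f
    (fun x hx => h x (Matrix.posSemidef_of_sum_nonneg x.2.1 hx) x.2.2) (fun y => by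
      obtain ⟨t, ht⟩ := exists_smul_one_add_mem_nonnegQuadFormCone y
      refine ⟨⟨t • 1, ⟨fun u v => by simp [Matrix.one_apply, eq_comm], fun u v huv => ?_⟩⟩, ht⟩
      simp [huv.ne])
  let e : V → V → Matrix V V ℝ := fun u v => Matrix.single u v 1
  have hcoe : ∀ u v, ¬ G.Adj u v → g (e u v) + g (e v u) = C u v + C v u := by
    intro u v huv
    have hmem : e u v + e v u ∈ G.symmVanishing := by
      refine ⟨fun a b => ?_, fun a b hab => ?_⟩
      · simp only [e, Matrix.add_apply, Matrix.single_apply]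
        rw [add_comm]
        simp only [and_comm]
      · have h1 : ¬ (u = a ∧ v = b) := by
          rintro ⟨rfl, rfl⟩
          exact huv hab
        have h2 : ¬ (v = a ∧ u = b) := by
          rintro ⟨rfl, rfl⟩
          exact huv hab.symm
        simp [e, h1, h2]
    have hF : ∀ u v, F (e u v) = C u v := by
      intro u v
      simp only [F, e, LinearMap.coe_mk, AddHom.coe_mk, Matrix.single_apply]
      rw [Finset.sum_eq_single u (by simp +contextual [eq_comm]) (by simp)]
      simp
    have := hgf ⟨_, hmem⟩
    rw [← map_add, ← hF u v, ← hF v u, ← map_add]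
    exact this
  -- `g` need not be invariant under transposition, hence the symmetrisation. The quadratic form of
  -- this matrix at `x` is `g` of the rank-one matrix `x xᵀ`, which lies in the cone.
  refine ⟨fun u v => (g (e u v) + g (e v u)) / 2, ?_, fun u v huv => ?_⟩
  · refine Matrix.posSemidef_of_sum_nonneg (fun u v => by ring) fun x => ?_
    have hmem : (fun u v => x u * x v : Matrix V V ℝ) ∈ nonnegQuadFormCone V := by
      refine mem_nonnegQuadFormCone.2 fun y => ?_
      have : ∑ u, ∑ v, x u * x v * (y u * y v) = (∑ u, x u * y u) ^ 2 := by
        rw [sq, Finset.sum_mul_sum]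
        exact Finset.sum_congr rfl fun u _ => Finset.sum_congr rfl fun v _ => by ring
      rw [this]
      positivity
    have hpos := hg _ hmem
    have hexp : g (fun u v => x u * x v : Matrix V V ℝ) =
        ∑ u, ∑ v, g (e u v) * (x u * x v) := by
      conv_lhs => rw [Matrix.matrix_eq_sum_single (fun u v => x u * x v : Matrix V V ℝ)]
      simp only [map_sum]
      refine Finset.sum_congr rfl fun u _ => Finset.sum_congr rfl fun v _ => ?_
      have : Matrix.single u v (x u * x v) = (x u * x v) • e u v := by simp [e]
      rw [this, map_smul, smul_eq_mul, mul_comm]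
    have hswap : ∑ u, ∑ v, g (e v u) * (x u * x v) = ∑ u, ∑ v, g (e u v) * (x u * x v) := by
      rw [Finset.sum_comm]
      simp only [mul_comm (x _) (x _)]
    have htot : ∑ u, ∑ v, (g (e u v) + g (e v u)) / 2 * (x u * x v) =
        (∑ u, ∑ v, g (e u v) * (x u * x v) + ∑ u, ∑ v, g (e v u) * (x u * x v)) / 2 := by
      simp only [← Finset.sum_add_distrib, Finset.sum_div]
      exact Finset.sum_congr rfl fun u _ => Finset.sum_congr rfl fun v _ => by ring
    rw [htot, hswap, ← hexp]
    linarith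
  · simp only [hcoe u v huv, hC v u]
    ring

theorem weightedShannonCapacity_le_weightedLovaszNumber [Nonempty V] (G : SimpleGraph V)
    (p : V → ℝ≥0) : G.weightedShannonCapacity p ≤ G.weightedLovaszNumber p := by
  classical
  set θ := G.weightedLovaszNumber p with hθ
  -- For `p ≠ 0` one has `θ > 0`, which the division by `√θ` below requires.
  rcases eq_or_ne p 0 with rfl | hp
  · refine (G.weightedShannonCapacity_le_of_rep 0 le_rfl
      (EuclideanSpace.single (Classical.arbitrary V) (1 : ℝ)) (by simp)
      (fun v => EuclideanSpace.single v 1) (by simp) ?_ (by simp)).trans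
      (G.weightedLovaszNumber_nonneg 0)
    intro u v huv _
    simp [EuclideanSpace.inner_single_left, huv]
  have hθpos : 0 < θ := by
    obtain ⟨v, hv⟩ := Function.ne_iff.1 hp
    exact (NNReal.coe_pos.2 (pos_iff_ne_zero.2 hv)).trans_le
      (G.weight_le_weightedLovaszNumber p v)
  let C : Matrix V V ℝ := fun u v => (if u = v then θ else 0) - √(p u : ℝ) * √(p v : ℝ)
  obtain ⟨Z, hZ, hZC⟩ := G.exists_posSemidef_eq_off_edges C
    (fun u v => by simp only [C, mul_comm, eq_comm]) fun M hM hadj => by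
      have := G.sum_sqrt_mul_sqrt_le p hM hadj
      have hsum : ∑ u, ∑ v, M u v * C u v =
          θ * ∑ v, M v v - ∑ u, ∑ v, M u v * (√(p u : ℝ) * √(p v : ℝ)) := by
        simp [C, mul_sub, Finset.sum_sub_distrib, Finset.mul_sum, mul_comm]
      rw [hsum]
      linarith
  obtain ⟨z, hz⟩ := hZ.exists_inner_eq
  let c : EuclideanSpace ℝ (Option V) := EuclideanSpace.single none 1
  -- The extra coordinate contributes `√(p u) √(p v)`, cancelling the rank-one part of `C` off the
  -- edges. Scaling by `√θ` makes the vectors unit, and the handle `c` reads off `p v / θ`.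
  let φ : V → EuclideanSpace ℝ (Option V) := fun v =>
    WithLp.toLp 2 fun o => o.elim (√(p v : ℝ) / √θ) fun i => z v i / √θ
  have hsq : √θ * √θ = θ := Real.mul_self_sqrt hθpos.le
  have hφ : ∀ u v, ¬ G.Adj u v → inner ℝ (φ u) (φ v) = if u = v then (1 : ℝ) else 0 := by
    intro u v huv
    have h1 : inner ℝ (φ u) (φ v) =
        (√(p u : ℝ) * √(p v : ℝ) + inner ℝ (z u) (z v)) / (√θ * √θ) := by
      simp only [φ, PiLp.inner_apply, RCLike.inner_apply, conj_trivial, Fintype.sum_option,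
        Option.elim, add_div, Finset.sum_div]
      congr 1
      · ring
      · exact Finset.sum_congr rfl fun i _ => by ring
    rw [h1, hsq, hz, hZC u v huv]
    simp only [C, add_sub_cancel]
    split_ifs
    · exact div_self hθpos.ne'
    · simp
  refine G.weightedShannonCapacity_le_of_rep p hθpos.le c (by simp [c]) φ (fun v => ?_)
    (fun u v huv hadj => by rw [hφ u v hadj, if_neg huv]) fun v => ?_
  · have := hφ v v (G.irrefl)
    rw [real_inner_self_eq_norm_sq, if_pos rfl] at this
    exact (pow_eq_one_iff_of_nonneg (norm_nonneg _) two_ne_zero).1 this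
  · simp only [c, EuclideanSpace.inner_single_right, φ, Option.elim]
    simp only [conj_trivial, one_mul, div_pow, Real.sq_sqrt hθpos.le,
      Real.sq_sqrt (NNReal.coe_nonneg _)]
    rw [mul_div_cancel₀ _ hθpos.ne']

/-! ### Dual capacities -/

section Dual

theorem weight_inner_self_pos {q : V → ℝ≥0} (hq : q ≠ 0) :
    0 < ∑ v, (q v : ℝ) * (q v : ℝ) := by
  obtain ⟨v, hv⟩ := Function.ne_iff.1 hq
  have : (0 : ℝ) < q v := NNReal.coe_pos.2 (pos_iff_ne_zero.2 hv)
  exact Finset.sum_pos' (fun v _ => mul_self_nonneg _) ⟨v, Finset.mem_univ v, mul_pos this this⟩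

theorem ratioValues_nonempty [Nonempty V] (f : (V → ℝ≥0) → ℝ) (p : V → ℝ≥0) :
    (ratioValues f p).Nonempty :=
  ⟨_, 1, one_ne_zero, rfl⟩

theorem ratio_le_weightedFracPackingNumber (G : SimpleGraph V) (p : V → ℝ≥0) {x : ℝ}
    (hx : x ∈ ratioValues Gᶜ.weightedShannonCapacity p) :
    x ≤ G.weightedFracPackingNumber p := by
  obtain ⟨q, hq, rfl⟩ := hx
  set a := Gᶜ.weightedIndepNum q with ha
  have hapos : 0 < a := Gᶜ.weightedIndepNum_pos hq
  calc (∑ v, (p v : ℝ) * (q v : ℝ)) / Gᶜ.weightedShannonCapacity q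
      ≤ (∑ v, (p v : ℝ) * (q v : ℝ)) / a :=
        div_le_div_of_nonneg_left (by positivity) hapos
          (Gᶜ.weightedIndepNum_le_weightedShannonCapacity q)
    _ ≤ G.weightedFracPackingNumber p := by
        refine (G.isGreatest_weightedFracPackingNumber p).2
          ⟨fun v => q v / a, fun v => ⟨by positivity, ?_⟩, fun C hC => ?_, ?_⟩
        · exact (div_le_one hapos).2 (Gᶜ.weight_le_weightedIndepNum q v)
        · rw [← Finset.sum_div, div_le_one hapos]
          exact Gᶜ.sum_le_weightedIndepNum q ((isIndepSet_compl G).2 hC)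
        · simp only [Finset.sum_div, mul_div_assoc]

variable [Nonempty V]

theorem isLUB_dualShannonCapacity (G : SimpleGraph V) (p : V → ℝ≥0) :
    IsLUB (ratioValues Gᶜ.weightedShannonCapacity p) (G.dualShannonCapacity p) :=
  isLUB_csSup (ratioValues_nonempty _ _)
    ⟨_, fun _ hx => G.ratio_le_weightedFracPackingNumber p hx⟩

theorem dualShannonCapacity_le_weightedFracPackingNumber (G : SimpleGraph V) (p : V → ℝ≥0) :
    G.dualShannonCapacity p ≤ G.weightedFracPackingNumber p :=
  (G.isLUB_dualShannonCapacity p).2 fun _ hx => G.ratio_le_weightedFracPackingNumber p hx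

theorem ratio_le_dualShannonCapacity (G : SimpleGraph V) (p : V → ℝ≥0) {q : V → ℝ≥0}
    (hq : q ≠ 0) :
    (∑ v, (p v : ℝ) * (q v : ℝ)) / Gᶜ.weightedShannonCapacity q ≤ G.dualShannonCapacity p :=
  (G.isLUB_dualShannonCapacity p).1 ⟨q, hq, rfl⟩

theorem dualShannonCapacity_pos (G : SimpleGraph V) {p : V → ℝ≥0} (hp : p ≠ 0) :
    0 < G.dualShannonCapacity p :=
  (div_pos (weight_inner_self_pos hp) (Gᶜ.weightedShannonCapacity_pos hp)).trans_le
    (G.ratio_le_dualShannonCapacity p hp)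

theorem dualShannonCapacity_nonneg (G : SimpleGraph V) (p : V → ℝ≥0) :
    0 ≤ G.dualShannonCapacity p := by
  refine le_trans ?_ (G.ratio_le_dualShannonCapacity p (one_ne_zero (α := V → ℝ≥0)))
  exact div_nonneg (by positivity) (weightedShannonCapacity_nonneg _ _)

/-- The weight `p` is itself a competitor in the supremum for `Θ̂_{Gᶜ}(q)`; cross-multiplying
exchanges the two denominators. -/
theorem ratio_le_weightedShannonCapacity (G : SimpleGraph V) (p : V → ℝ≥0) {x : ℝ}
    (hx : x ∈ ratioValues Gᶜ.dualShannonCapacity p) : x ≤ G.weightedShannonCapacity p := by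
  obtain ⟨q, hq, rfl⟩ := hx
  rcases eq_or_ne p 0 with rfl | hp
  · simpa using G.weightedShannonCapacity_nonneg 0
  have h := Gᶜ.ratio_le_dualShannonCapacity q hp
  rw [compl_compl, div_le_iff₀ (G.weightedShannonCapacity_pos hp)] at h
  rw [div_le_iff₀ (Gᶜ.dualShannonCapacity_pos hq), mul_comm (G.weightedShannonCapacity p)]
  simpa only [mul_comm (q _ : ℝ)] using h

theorem isLUB_doubleDualShannonCapacity (G : SimpleGraph V) (p : V → ℝ≥0) :
    IsLUB (ratioValues Gᶜ.dualShannonCapacity p) (G.doubleDualShannonCapacity p) :=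
  isLUB_csSup (ratioValues_nonempty _ _)
    ⟨_, fun _ hx => G.ratio_le_weightedShannonCapacity p hx⟩

theorem doubleDualShannonCapacity_le_weightedShannonCapacity (G : SimpleGraph V)
    (p : V → ℝ≥0) : G.doubleDualShannonCapacity p ≤ G.weightedShannonCapacity p :=
  (G.isLUB_doubleDualShannonCapacity p).2 fun _ hx => G.ratio_le_weightedShannonCapacity p hx

theorem ratio_le_doubleDualShannonCapacity (G : SimpleGraph V) (p : V → ℝ≥0) {q : V → ℝ≥0}
    (hq : q ≠ 0) :
    (∑ v, (p v : ℝ) * (q v : ℝ)) / Gᶜ.dualShannonCapacity q ≤ G.doubleDualShannonCapacity p :=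
  (G.isLUB_doubleDualShannonCapacity p).1 ⟨q, hq, rfl⟩

theorem weightedIndepNum_le_doubleDualShannonCapacity (G : SimpleGraph V) (p : V → ℝ≥0) :
    G.weightedIndepNum p ≤ G.doubleDualShannonCapacity p := by
  classical
  refine (G.weightedIndepNum_le_iff p).2 fun I hI => ?_
  rcases I.eq_empty_or_nonempty with rfl | ⟨w, hw⟩
  · rw [Finset.sum_empty]
    refine le_trans ?_ (G.ratio_le_doubleDualShannonCapacity p (one_ne_zero (α := V → ℝ≥0)))
    exact div_nonneg (by positivity) (dualShannonCapacity_nonneg _ _)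
  let q : V → ℝ≥0 := fun v => if v ∈ I then 1 else 0
  have hq : q ≠ 0 := Function.ne_iff.2 ⟨w, by simp [q, hw]⟩
  have hle : Gᶜ.dualShannonCapacity q ≤ 1 :=
    (Gᶜ.dualShannonCapacity_le_weightedFracPackingNumber q).trans
      (Gᶜ.weightedFracPackingNumber_le_one ((isClique_compl G).2 hI) fun v => by simp [q, apply_ite])
  calc ∑ v ∈ I, (p v : ℝ) = (∑ v, (p v : ℝ) * (q v : ℝ)) / 1 := by simp [q, apply_ite]
    _ ≤ (∑ v, (p v : ℝ) * (q v : ℝ)) / Gᶜ.dualShannonCapacity q :=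
        div_le_div_of_nonneg_left (by positivity) (Gᶜ.dualShannonCapacity_pos hq) hle
    _ ≤ _ := G.ratio_le_doubleDualShannonCapacity p hq

theorem weightedLovaszNumber_le_dualShannonCapacity (G : SimpleGraph V) (p : V → ℝ≥0) :
    G.weightedLovaszNumber p ≤ G.dualShannonCapacity p := by
  obtain ⟨c, ψ, hc, hψ, h⟩ := (G.isGreatest_weightedLovaszNumber p).1
  rw [h]
  let q : V → ℝ≥0 := fun v => ⟨|inner ℝ c (ψ v)| ^ 2, by positivity⟩
  change ∑ v, (p v : ℝ) * (q v : ℝ) ≤ _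
  rcases eq_or_ne q 0 with hq | hq
  · simpa [hq] using G.dualShannonCapacity_nonneg p
  -- The optimal `ψ` represents `Gᶜ`, and `q` is chosen so that Lovász's bound holds with `t = 1`.
  have hle : Gᶜ.weightedShannonCapacity q ≤ 1 :=
    Gᶜ.weightedShannonCapacity_le_of_rep q zero_le_one c hc ψ hψ.1 hψ.2 fun v => by
      rw [one_mul, real_inner_comm, ← sq_abs]
      exact le_rfl
  calc ∑ v, (p v : ℝ) * (q v : ℝ) = (∑ v, (p v : ℝ) * (q v : ℝ)) / 1 := (div_one _).symm
    _ ≤ (∑ v, (p v : ℝ) * (q v : ℝ)) / Gᶜ.weightedShannonCapacity q :=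
        div_le_div_of_nonneg_left (by positivity) (Gᶜ.weightedShannonCapacity_pos hq) hle
    _ ≤ _ := G.ratio_le_dualShannonCapacity p hq

end Dual

end SimpleGraph
/-- The first group of conjuncts says that the maxima, the limit and the suprema that define the
six quantities exist; the second group is the chain of inequalities. -/
theorem mainTheorem6 {V : Type*} [Fintype V] [Nonempty V] (G : SimpleGraph V) (p : V → ℝ≥0) :
    (IsGreatest (G.indepSetWeights p) (G.weightedIndepNum p) ∧
      Tendsto (G.shannonSeq p) atTop (𝓝 (G.weightedShannonCapacity p)) ∧
      IsGreatest (G.lovaszValues p) (G.weightedLovaszNumber p) ∧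
      IsGreatest (G.packingValues p) (G.weightedFracPackingNumber p) ∧
      IsLUB (ratioValues Gᶜ.weightedShannonCapacity p) (G.dualShannonCapacity p) ∧
      IsLUB (ratioValues Gᶜ.dualShannonCapacity p) (G.doubleDualShannonCapacity p)) ∧
    (G.weightedIndepNum p ≤ G.doubleDualShannonCapacity p ∧
      G.doubleDualShannonCapacity p ≤ G.weightedShannonCapacity p ∧
      G.weightedShannonCapacity p ≤ G.weightedLovaszNumber p ∧
      G.weightedLovaszNumber p ≤ G.dualShannonCapacity p ∧
      G.dualShannonCapacity p ≤ G.weightedFracPackingNumber p) :=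
  ⟨⟨G.isGreatest_weightedIndepNum p, G.tendsto_shannonSeq p, G.isGreatest_weightedLovaszNumber p,
      G.isGreatest_weightedFracPackingNumber p, G.isLUB_dualShannonCapacity p,
      G.isLUB_doubleDualShannonCapacity p⟩,
    G.weightedIndepNum_le_doubleDualShannonCapacity p,
    G.doubleDualShannonCapacity_le_weightedShannonCapacity p,
    G.weightedShannonCapacity_le_weightedLovaszNumber p,
    G.weightedLovaszNumber_le_dualShannonCapacity p,
    G.dualShannonCapacity_le_weightedFracPackingNumber p⟩
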